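/- Let $n$ be a positive integer. If $n$ is even, then $$\frac{2n\ln 2}{\pi}+\frac{\pi}{12n}-\frac{7\pi^3}{1440n^3}\;<\;\sum_{l=1}^{n-1}(-1)^{l+1}\csc\frac{\pi l}{n}\;<\;\frac{2n\ln 2}{\pi}+\frac{\pi}{12n}.$$ If $n$ is odd, then $$\sum_{l=1}^{n-1}(-1)^{l+1}\csc\frac{\pi l}{n}=0$$ (for $n=1$ the sum is empty). Here $\csc x=1/\sin x$. -/

import Mathlib

open Filter Topology

/-! For odd `n` the reflection `l ↦ n - l` negates the sum. For `n = 2m`, expand `π csc (π l / n)`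
in partial fractions: `π S` becomes `n` times an alternating sum of the blocks `altBlock n k`, each
a difference of partial sums `H` of the series for `log 2` plus a boundary term. Summation by parts
leaves the tails `log 2 - H(j) = 1/(4j) - 1/(16j²) + E(j)` at multiples of `m`, where `E` is
`tailError`. The `1/j` parts cancel, the `1/j²` parts give `π/(12n)`, and `S = 2n log 2/π + π/(12n)
- 4nA/π` with `A = ∑ (-1)^i E((i+1)m)`. Both `E(j)` and `1/(128j⁴) - E(j)` strictly decrease for `j
≥ 1`, so `0 < A < 7π⁴/(5760n⁴)`, using `ζ(4)`. -/

theorem sum_range_two_mul_alternating (g : ℕ → ℝ) (K : ℕ) :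
    ∑ i ∈ Finset.range (2 * K), (-1 : ℝ) ^ i * g i
      = ∑ i ∈ Finset.range (2 * K), g i - 2 * ∑ j ∈ Finset.range K, g (2 * j + 1) := by
  induction K with
  | zero => simp
  | succ K ih =>
    rw [show 2 * (K + 1) = 2 * K + 1 + 1 by ring]
    simp only [Finset.sum_range_succ, ih, pow_succ, pow_mul]
    norm_num
    ring

theorem tendsto_two_mul_atTop : Tendsto (fun K : ℕ => 2 * K) atTop atTop :=
  tendsto_id.const_mul_atTop' (by norm_num)

/-- The alternating sum `1 - 1/2 + ⋯ - 1/(2j)`. -/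
noncomputable def altHarmonic (j : ℕ) : ℝ :=
  ∑ i ∈ Finset.range (2 * j), (-1 : ℝ) ^ i * (1 / ((i : ℝ) + 1))

theorem altHarmonic_succ (j : ℕ) :
    altHarmonic (j + 1) = altHarmonic j + (1 / (2 * (j : ℝ) + 1) - 1 / (2 * (j : ℝ) + 2)) := by
  unfold altHarmonic
  rw [show 2 * (j + 1) = 2 * j + 1 + 1 by ring, Finset.sum_range_succ, Finset.sum_range_succ]
  simp only [pow_succ, pow_mul]
  push_cast
  norm_num
  ring

theorem tendsto_altHarmonic : Tendsto altHarmonic atTop (𝓝 (Real.log 2)) := by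
  have h1 := Real.tendsto_harmonic_sub_log
  -- Euler's constant cancels between indices `2j` and `j`, leaving `log (2j) - log j = log 2`.
  have h2 := (h1.comp tendsto_two_mul_atTop).sub h1
  have h3 := h2.add_const (Real.log 2)
  rw [sub_self, zero_add] at h3
  refine h3.congr' ?_
  filter_upwards [eventually_ge_atTop 1] with j hj
  have hj' : (j : ℝ) ≠ 0 := by positivity
  have hh : ∀ N : ℕ, ((harmonic N : ℚ) : ℝ) = ∑ i ∈ Finset.range N, 1 / ((i : ℝ) + 1) := by
    intro N
    simp [harmonic]
  unfold altHarmonic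
  rw [sum_range_two_mul_alternating (fun i => 1 / ((i : ℝ) + 1)) j]
  simp only [Function.comp_apply, hh]
  have h4 : 2 * ∑ i ∈ Finset.range j, 1 / (((2 * i + 1 : ℕ) : ℝ) + 1)
      = ∑ i ∈ Finset.range j, 1 / ((i : ℝ) + 1) := by
    rw [Finset.mul_sum]
    refine Finset.sum_congr rfl fun i _ => ?_
    have : (i : ℝ) + 1 ≠ 0 := by positivity
    push_cast
    field_simp
    ring
  rw [h4]
  push_cast
  rw [Real.log_mul two_ne_zero hj']
  ring

/-- The tail `log 2 - altHarmonic j`, compared with two terms of its asymptotic expansion. -/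
noncomputable def tailError (j : ℕ) : ℝ :=
  1 / (16 * (j : ℝ) ^ 2) - 1 / (4 * (j : ℝ)) + (Real.log 2 - altHarmonic j)

theorem tendsto_const_div_natCast_pow (a : ℝ) {s : ℕ} (hs : s ≠ 0) :
    Tendsto (fun j : ℕ => 1 / (a * (j : ℝ) ^ s)) atTop (𝓝 0) := by
  have h := (tendsto_pow_neg_atTop (𝕜 := ℝ) hs).comp tendsto_natCast_atTop_atTop
  have h2 := h.const_mul (1 / a)
  rw [mul_zero] at h2
  refine h2.congr fun j => ?_
  simp [zpow_neg, mul_comm]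

theorem tendsto_tailError : Tendsto tailError atTop (𝓝 0) := by
  have h := ((tendsto_const_div_natCast_pow 16 two_ne_zero).sub
    (tendsto_const_div_natCast_pow 4 one_ne_zero)).add
    (tendsto_altHarmonic.const_sub (Real.log 2))
  simp only [sub_self, add_zero, pow_one] at h
  exact h

theorem tailError_sub_succ {j : ℕ} (hj : 1 ≤ j) :
    tailError j - tailError (j + 1)
      = 1 / ((2 * (j : ℝ) + 1) * (2 * (j : ℝ)) ^ 2 * (2 * (j : ℝ) + 2) ^ 2) := by
  have hj' : (0 : ℝ) < j := by exact_mod_cast hj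
  unfold tailError
  rw [altHarmonic_succ]
  push_cast
  field_simp
  ring

theorem tailError_succ_lt {j : ℕ} (hj : 1 ≤ j) : tailError (j + 1) < tailError j := by
  rw [← sub_pos, tailError_sub_succ hj]
  have hj' : (0 : ℝ) < j := by exact_mod_cast hj
  positivity

/-- `1/(128j⁴)` is the next term of the asymptotic expansion of the tail. -/
theorem inv_pow_four_sub_tailError_succ_lt {j : ℕ} (hj : 1 ≤ j) :
    1 / (128 * ((j + 1 : ℕ) : ℝ) ^ 4) - tailError (j + 1)
      < 1 / (128 * (j : ℝ) ^ 4) - tailError j := by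
  have hj' : (0 : ℝ) < j := by exact_mod_cast hj
  have h := tailError_sub_succ hj
  have key : 1 / (128 * (j : ℝ) ^ 4) - 1 / (128 * ((j + 1 : ℕ) : ℝ) ^ 4)
      - 1 / ((2 * (j : ℝ) + 1) * (2 * (j : ℝ)) ^ 2 * (2 * (j : ℝ) + 2) ^ 2)
      = (6 * (j : ℝ) ^ 2 + 6 * j + 1)
        / (128 * (j : ℝ) ^ 4 * ((j : ℝ) + 1) ^ 4 * (2 * (j : ℝ) + 1)) := by
    push_cast
    field_simp
    ring
  have hpos : 0 < (6 * (j : ℝ) ^ 2 + 6 * j + 1)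
        / (128 * (j : ℝ) ^ 4 * ((j : ℝ) + 1) ^ 4 * (2 * (j : ℝ) + 1)) := by positivity
  linarith

/-! ### Alternating series -/

theorem strictAnti_comp_succ_mul {u : ℕ → ℝ} (hu : ∀ j, 1 ≤ j → u (j + 1) < u j) {m : ℕ}
    (hm : 1 ≤ m) : StrictAnti fun i : ℕ => u ((i + 1) * m) := by
  have h1 : StrictAnti fun i : ℕ => u (i + 1) := strictAnti_nat_of_succ_lt fun i => hu _ (by omega)
  have h2 : StrictMono fun i : ℕ => (i + 1) * m - 1 := by
    refine strictMono_nat_of_lt_succ fun i => ?_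
    have : 1 ≤ (i + 1) * m := Nat.mul_pos (by omega) hm
    have h3 : (i + 1 + 1) * m = (i + 1) * m + m := by ring
    omega
  have h := h1.comp_strictMono h2
  refine (congrArg StrictAnti (funext fun i => ?_)).mp h
  have : 1 ≤ (i + 1) * m := Nat.mul_pos (by omega) hm
  simp only [Function.comp_apply]
  rw [Nat.sub_add_cancel this]

/-- Pairing consecutive terms bounds the even partial sums below by `u 0 - u 1`; no sign condition
on `u` is needed. -/
theorem alternating_limit_pos {u : ℕ → ℝ} (hu : StrictAnti u) {L : ℝ}
    (h : Tendsto (fun K : ℕ => ∑ i ∈ Finset.range (2 * K), (-1 : ℝ) ^ i * u i) atTop (𝓝 L)) :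
    0 < L := by
  have h01 : 0 < u 0 - u 1 := sub_pos.2 (hu Nat.zero_lt_one)
  refine h01.trans_le (ge_of_tendsto h ?_)
  filter_upwards [eventually_ge_atTop 1] with K hK
  induction K, hK using Nat.le_induction with
  | base => simp [Finset.sum_range_succ, sub_eq_add_neg]
  | succ K hK ih =>
    rw [show 2 * (K + 1) = 2 * K + 1 + 1 by ring, Finset.sum_range_succ, Finset.sum_range_succ]
    have := hu (Nat.lt_succ_self (2 * K))
    simp only [pow_succ, pow_mul]
    norm_num
    simp only [Nat.succ_eq_add_one] at this
    linarith

theorem tendsto_alternating_inv_pow {s : ℕ} {Z : ℝ}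
    (h : HasSum (fun n : ℕ => (1 : ℝ) / (n : ℝ) ^ s) Z) (hs : s ≠ 0) :
    Tendsto (fun K : ℕ => ∑ i ∈ Finset.range (2 * K), (-1 : ℝ) ^ i * (1 / ((i : ℝ) + 1) ^ s))
      atTop (𝓝 ((1 - 2 / 2 ^ s) * Z)) := by
  have h1 : Tendsto (fun N : ℕ => ∑ i ∈ Finset.range N, 1 / ((i : ℝ) + 1) ^ s) atTop (𝓝 Z) := by
    have h2 := h.tendsto_sum_nat.comp (tendsto_add_atTop_nat 1)
    refine h2.congr fun N => ?_
    simp [Finset.sum_range_succ', hs]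
  have h3 := (h1.comp tendsto_two_mul_atTop).sub (h1.const_mul (2 / 2 ^ s))
  rw [show Z - 2 / 2 ^ s * Z = (1 - 2 / 2 ^ s) * Z by ring] at h3
  refine h3.congr fun K => ?_
  rw [sum_range_two_mul_alternating (fun i => 1 / ((i : ℝ) + 1) ^ s) K]
  simp only [Function.comp_apply, Finset.mul_sum]
  congr 1
  refine Finset.sum_congr rfl fun i _ => ?_
  push_cast
  rw [show (2 * (i : ℝ) + 1 + 1) = 2 * ((i : ℝ) + 1) by ring, mul_pow]
  have : (i : ℝ) + 1 ≠ 0 := by positivity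
  field_simp

/-! ### Partial fractions of cotangent and cosecant -/

theorem tendsto_sum_cot {x : ℝ} (h0 : 0 < x) (h1 : x < 1) :
    Tendsto (fun N : ℕ => ∑ j ∈ Finset.range N, (1 / (x - ((j : ℝ) + 1)) + 1 / (x + ((j : ℝ) + 1))))
      atTop (𝓝 (Real.pi * (Real.cos (Real.pi * x) / Real.sin (Real.pi * x)) - 1 / x)) := by
  have hx : (x : ℂ) ∈ Complex.integerComplement := by
    rintro ⟨k, hk⟩
    have hk' : (k : ℝ) = x := by exact_mod_cast hk
    rw [← hk'] at h0 h1
    have : (0 : ℤ) < k := by exact_mod_cast h0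
    have : k < (1 : ℤ) := by exact_mod_cast h1
    omega
  have h := tendsto_logDeriv_euler_cot_sub hx
  rw [Complex.cot] at h
  rw [← Filter.tendsto_ofReal_iff]
  convert h using 2 with N
  · simp [cotTerm]
  · simp

/-- Follows from `csc (2θ) = cot θ - cot (2θ)` with `θ = πx/2`. -/
theorem tendsto_sum_csc {x : ℝ} (h0 : 0 < x) (h1 : x < 1) :
    Tendsto (fun K : ℕ => 1 / x + ∑ k ∈ Finset.range (2 * K),
        (-1 : ℝ) ^ (k + 1) * (1 / (x - ((k : ℝ) + 1)) + 1 / (x + ((k : ℝ) + 1))))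
      atTop (𝓝 (Real.pi * (1 / Real.sin (Real.pi * x)))) := by
  have hA := (tendsto_sum_cot h0 h1).comp tendsto_two_mul_atTop
  have hB := tendsto_sum_cot (half_pos h0) (by linarith : x / 2 < 1)
  have h := (hB.sub hA).const_add (1 / x)
  have hs : 0 < Real.sin (Real.pi * (x / 2)) := by
    apply Real.sin_pos_of_pos_of_lt_pi
    · positivity
    · nlinarith [Real.pi_pos]
  have hc : 0 < Real.cos (Real.pi * (x / 2)) := by
    apply Real.cos_pos_of_mem_Ioo
    constructor <;> nlinarith [Real.pi_pos]
  convert h using 2 with K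
  · congr 1
    have e := sum_range_two_mul_alternating
      (fun k => 1 / (x - ((k : ℝ) + 1)) + 1 / (x + ((k : ℝ) + 1))) K
    simp only [pow_succ, mul_neg, mul_one, neg_mul, Finset.sum_neg_distrib, Function.comp_apply]
    rw [e, neg_sub]
    congr 1
    rw [Finset.mul_sum]
    refine Finset.sum_congr rfl fun j _ => ?_
    push_cast
    rw [show x - (2 * (j : ℝ) + 1 + 1) = 2 * (x / 2 - (j + 1)) by ring,
      show x + (2 * (j : ℝ) + 1 + 1) = 2 * (x / 2 + (j + 1)) by ring]
    simp only [one_div, mul_inv]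
    ring
  · rw [show Real.pi * x = 2 * (Real.pi * (x / 2)) by ring, Real.sin_two_mul, Real.cos_two_mul]
    generalize Real.sin (Real.pi * (x / 2)) = s at hs
    generalize Real.cos (Real.pi * (x / 2)) = c at hc
    field_simp
    ring

/-- The alternating sum of `1 / (l + k n)` over `0 < l < n`. -/
noncomputable def altBlock (n k : ℕ) : ℝ :=
  ∑ l ∈ Finset.Ico 1 n, (-1 : ℝ) ^ (l + 1) * (1 / ((l : ℝ) + k * n))

/-- Under `l ↦ n - l` the sign `(-1)^(l+1)` survives because `n` is even. -/
theorem altBlock_reflect {n : ℕ} (hn : Even n) (k : ℕ) :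
    ∑ l ∈ Finset.Ico 1 n, (-1 : ℝ) ^ (l + 1) * (1 / ((l : ℝ) - (k + 1) * n)) = -altBlock n k := by
  unfold altBlock
  rw [← Finset.sum_neg_distrib]
  refine Finset.sum_bij' (fun l _ => n - l) (fun l _ => n - l) ?_ ?_ ?_ ?_ ?_
  · intro l hl; simp only [Finset.mem_Ico] at *; omega
  · intro l hl; simp only [Finset.mem_Ico] at *; omega
  · intro l hl; simp only [Finset.mem_Ico] at *; omega
  · intro l hl; simp only [Finset.mem_Ico] at *; omega
  · intro l hl
    simp only [Finset.mem_Ico] at hl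
    have hp : (-1 : ℝ) ^ (n - l + 1) = (-1) ^ (l + 1) := by
      rw [neg_one_pow_congr]
      rw [Nat.even_add_one, Nat.even_add_one, Nat.even_sub hl.2.le]
      simp [hn]
    rw [hp, Nat.cast_sub hl.2.le, ← mul_neg, ← one_div_neg_eq_neg_one_div]
    congr 2
    ring

theorem altBlock_eq {m : ℕ} (hm : 1 ≤ m) (k : ℕ) :
    altBlock (2 * m) k
      = altHarmonic ((k + 1) * m) - altHarmonic (k * m) + 1 / (2 * (((k : ℝ) + 1) * m)) := by
  unfold altHarmonic altBlock
  have e : 2 * ((k + 1) * m) = 2 * (k * m) + 2 * m := by ring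
  obtain ⟨t, rfl⟩ : ∃ t, m = t + 1 := ⟨m - 1, by omega⟩
  rw [e, Finset.sum_range_add, add_sub_cancel_left, show 2 * (t + 1) = (2 * t + 1) + 1 by ring,
    Finset.sum_range_succ _ (2 * t + 1), Finset.sum_Ico_eq_sum_range]
  have h1 : (-1 : ℝ) ^ (2 * (k * (t + 1)) + (2 * t + 1))
      * (1 / (((2 * (k * (t + 1)) + (2 * t + 1) : ℕ) : ℝ) + 1))
      = -(1 / (2 * (((k : ℝ) + 1) * ((t + 1 : ℕ) : ℝ)))) := by
    rw [show 2 * (k * (t + 1)) + (2 * t + 1) = 2 * (k * (t + 1) + t) + 1 by ring, pow_succ,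
      pow_mul, neg_one_sq, one_pow, one_mul, neg_one_mul]
    push_cast
    congr 3
    ring
  rw [h1, neg_add_cancel_right]
  refine Finset.sum_congr (by simp) fun i _ => ?_
  rw [show 1 + i + 1 = i + 2 by ring, pow_add, pow_add, pow_mul]
  push_cast
  rw [show 2 * ((k : ℝ) * (t + 1)) + i + 1 = 1 + i + k * (2 * t + 1 + 1) by ring]
  norm_num

/-! ### Summation by parts over the blocks -/

theorem sum_range_alternating_diff (f : ℕ → ℝ) (N : ℕ) :
    f 0 + ∑ k ∈ Finset.range N, (-1 : ℝ) ^ (k + 1) * (f (k + 1) - f k)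
      = 2 * ∑ k ∈ Finset.range N, (-1 : ℝ) ^ k * f k + (-1) ^ N * f N := by
  induction N with
  | zero => simp
  | succ N ih =>
    rw [Finset.sum_range_succ, Finset.sum_range_succ, ← add_assoc, ih]
    ring

theorem sum_range_alternating_telescope (b c : ℕ → ℝ) (N : ℕ) :
    ∑ k ∈ Finset.range N, (-1 : ℝ) ^ k * (b k - b (k + 1) + (c k + c (k + 1)))
      = b 0 - 2 * ∑ i ∈ Finset.range N, (-1 : ℝ) ^ i * b (i + 1) - (-1) ^ N * b N
        + (c 0 - (-1) ^ N * c N) := by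
  induction N with
  | zero => simp
  | succ N ih =>
    rw [Finset.sum_range_succ, Finset.sum_range_succ, ih]
    ring

theorem tendsto_csc_sum {n : ℕ} (hn : Even n) :
    Tendsto (fun K : ℕ => (n : ℝ) * (2 * ∑ k ∈ Finset.range (2 * K), (-1 : ℝ) ^ k * altBlock n k
        + altBlock n (2 * K))) atTop
      (𝓝 (Real.pi * ∑ l ∈ Finset.Ico 1 n,
        (-1 : ℝ) ^ (l + 1) * (1 / Real.sin (Real.pi * (l : ℝ) / (n : ℝ))))) := by
  rw [Finset.mul_sum]
  have key : Tendsto (fun K : ℕ => ∑ l ∈ Finset.Ico 1 n, (-1 : ℝ) ^ (l + 1) *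
      (1 / ((l : ℝ) / n) + ∑ k ∈ Finset.range (2 * K),
        (-1 : ℝ) ^ (k + 1) * (1 / ((l : ℝ) / n - ((k : ℝ) + 1)) + 1 / ((l : ℝ) / n + ((k : ℝ) + 1)))))
      atTop (𝓝 (∑ l ∈ Finset.Ico 1 n,
        Real.pi * ((-1 : ℝ) ^ (l + 1) * (1 / Real.sin (Real.pi * (l : ℝ) / (n : ℝ)))))) := by
    refine tendsto_finsetSum _ fun l hl => ?_
    simp only [Finset.mem_Ico] at hl
    have hl0 : (0 : ℝ) < l := by exact_mod_cast hl.1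
    have hln : (l : ℝ) < n := by exact_mod_cast hl.2
    have h := (tendsto_sum_csc (div_pos hl0 (hl0.trans hln))
      ((div_lt_one (hl0.trans hln)).2 hln)).const_mul ((-1 : ℝ) ^ (l + 1))
    rw [mul_left_comm, ← mul_div_assoc Real.pi (l : ℝ)] at h
    exact h
  refine key.congr fun K => ?_
  have e := sum_range_alternating_diff (altBlock n) (2 * K)
  rw [pow_mul, neg_one_sq, one_pow, one_mul] at e
  rw [← e]
  have hscale : ∀ l ∈ Finset.Ico 1 n, (n : ℝ) ≠ 0 := by
    intro l hl
    simp only [Finset.mem_Ico] at hl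
    have : 0 < n := by omega
    positivity
  simp only [mul_add ((-1 : ℝ) ^ (_ + 1)) (1 / _) (Finset.sum _ _), Finset.sum_add_distrib]
  rw [mul_add]
  congr 1
  · unfold altBlock
    rw [Finset.mul_sum]
    refine Finset.sum_congr rfl fun l hl => ?_
    rw [one_div_div]
    simp
    ring
  · rw [Finset.mul_sum]
    simp only [Finset.mul_sum]
    rw [Finset.sum_comm]
    refine Finset.sum_congr rfl fun k _ => ?_
    rw [sub_eq_add_neg, ← altBlock_reflect hn k]
    unfold altBlock
    rw [← Finset.sum_add_distrib, Finset.mul_sum, Finset.mul_sum]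
    refine Finset.sum_congr rfl fun l hl => ?_
    have hn0 := hscale l hl
    rw [show (l : ℝ) / n - (k + 1) = ((l : ℝ) - (k + 1) * n) / n by field_simp,
      show (l : ℝ) / n + (k + 1) = ((l : ℝ) + (k + 1) * n) / n by field_simp,
      one_div_div, one_div_div]
    push_cast
    ring

theorem tendsto_sum_altBlock {m : ℕ} (hm : 1 ≤ m) {A : ℝ}
    (hA : Tendsto (fun K : ℕ => ∑ i ∈ Finset.range (2 * K), (-1 : ℝ) ^ i * tailError ((i + 1) * m))
      atTop (𝓝 A)) :
    Tendsto (fun K : ℕ => 2 * ∑ k ∈ Finset.range (2 * K), (-1 : ℝ) ^ k * altBlock (2 * m) k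
        + altBlock (2 * m) (2 * K)) atTop
      (𝓝 (2 * (Real.log 2 - 2 * (A - Real.pi ^ 2 / (192 * (m : ℝ) ^ 2))))) := by
  have hm' : (0 : ℝ) < m := by exact_mod_cast hm
  have hmul : Tendsto (fun k : ℕ => k * m) atTop atTop :=
    tendsto_id.atTop_mul_const' hm
  -- Division by zero makes `c 0 = 0`, hence `b 0 = log 2`. Subtracting `c` from the tail absorbs
  -- the boundary term of each block into `c k + c (k + 1)`, whose alternating sum telescopes.
  set c : ℕ → ℝ := fun k => 1 / (4 * ((k * m : ℕ) : ℝ)) with hc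
  set b : ℕ → ℝ := fun k => Real.log 2 - altHarmonic (k * m) - c k with hb
  have hc0 : Tendsto c atTop (𝓝 0) := by
    have := (tendsto_const_div_natCast_pow 4 one_ne_zero).comp hmul
    simpa only [Function.comp_def, pow_one] using this
  have hb0 : Tendsto b atTop (𝓝 0) := by
    have := ((tendsto_altHarmonic.comp hmul).const_sub (Real.log 2)).sub hc0
    simpa [Function.comp_def] using this
  have hf : ∀ k, altBlock (2 * m) k = b k - b (k + 1) + (c k + c (k + 1)) := by
    intro k
    rw [altBlock_eq hm]
    simp only [hb, hc]
    push_cast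
    field_simp
    ring
  have hf0 : Tendsto (altBlock (2 * m)) atTop (𝓝 0) := by
    have hs := tendsto_add_atTop_nat 1
    have := (hb0.sub (hb0.comp hs)).add (hc0.add (hc0.comp hs))
    simp only [sub_self, add_zero] at this
    exact this.congr fun k => (hf k).symm
  have hbsum : Tendsto (fun K : ℕ => ∑ i ∈ Finset.range (2 * K), (-1 : ℝ) ^ i * b (i + 1)) atTop
      (𝓝 (A - Real.pi ^ 2 / (192 * (m : ℝ) ^ 2))) := by
    have hz := (tendsto_alternating_inv_pow hasSum_zeta_two two_ne_zero).const_mul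
      (1 / (16 * (m : ℝ) ^ 2))
    have h := hA.sub hz
    convert h using 2 with K
    · rw [Finset.mul_sum, ← Finset.sum_sub_distrib]
      refine Finset.sum_congr rfl fun i _ => ?_
      simp only [hb, hc, tailError]
      push_cast
      rw [mul_pow, ← mul_assoc]
      field_simp
      ring
    · field_simp
      ring
  have hd := tendsto_two_mul_atTop
  have h := ((((hbsum.const_mul 2).const_sub (b 0)).sub (hb0.comp hd)).add
    ((hc0.comp hd).const_sub (c 0))).const_mul 2 |>.add (hf0.comp hd)
  convert h using 2 with K
  · congr 2
    simp only [hf]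
    rw [sum_range_alternating_telescope, pow_mul, neg_one_sq, one_pow]
    simp
  · simp [hb, hc, altHarmonic]

theorem mainTheorem4 (n : ℕ) (hn : 1 ≤ n) :
    (Even n →
      2 * (n : ℝ) * Real.log 2 / Real.pi + Real.pi / (12 * (n : ℝ))
            - 7 * Real.pi ^ 3 / (1440 * (n : ℝ) ^ 3)
          < ∑ l ∈ Finset.Ico 1 n, (-1 : ℝ) ^ (l + 1) * (1 / Real.sin (Real.pi * (l : ℝ) / (n : ℝ))) ∧
      ∑ l ∈ Finset.Ico 1 n, (-1 : ℝ) ^ (l + 1) * (1 / Real.sin (Real.pi * (l : ℝ) / (n : ℝ)))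
          < 2 * (n : ℝ) * Real.log 2 / Real.pi + Real.pi / (12 * (n : ℝ))) ∧
    (Odd n →
      ∑ l ∈ Finset.Ico 1 n, (-1 : ℝ) ^ (l + 1) * (1 / Real.sin (Real.pi * (l : ℝ) / (n : ℝ))) = 0) := by
  have hn0 : (0 : ℝ) < n := by exact_mod_cast hn
  have hpi := Real.pi_pos
  refine ⟨fun he => ?_, fun ho => ?_⟩
  · set S := ∑ l ∈ Finset.Ico 1 n,
      (-1 : ℝ) ^ (l + 1) * (1 / Real.sin (Real.pi * (l : ℝ) / (n : ℝ))) with hS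
    obtain ⟨m, hm2⟩ := he.two_dvd
    have hm : 1 ≤ m := by omega
    have hm' : (0 : ℝ) < m := by exact_mod_cast hm
    have hnm : (n : ℝ) = 2 * m := by exact_mod_cast hm2
    have hmul : Tendsto (fun i : ℕ => (i + 1) * m) atTop atTop :=
      (tendsto_add_atTop_nat 1).atTop_mul_const' hm
    have hanti := strictAnti_comp_succ_mul (fun j hj => tailError_succ_lt hj) hm
    obtain ⟨A, hA'⟩ := hanti.antitone.tendsto_alternating_series_of_tendsto_zero
      (tendsto_tailError.comp hmul)
    have hA := hA'.comp tendsto_two_mul_atTop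
    have hApos : 0 < A := alternating_limit_pos hanti hA
    have hQ := ((tendsto_alternating_inv_pow hasSum_zeta_four four_ne_zero).const_mul
      (1 / (128 * (m : ℝ) ^ 4))).sub hA
    -- Positivity of the limit here is the upper bound on `A`.
    have hQpos := alternating_limit_pos
      (strictAnti_comp_succ_mul
        (u := fun j => 1 / (128 * (j : ℝ) ^ 4) - tailError j) (fun j hj => inv_pow_four_sub_tailError_succ_lt hj) hm)
      (hQ.congr fun K => by
        simp only [Function.comp_apply]
        rw [Finset.mul_sum, ← Finset.sum_sub_distrib]
        refine Finset.sum_congr rfl fun i _ => ?_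
        push_cast
        rw [mul_pow]
        field_simp)
    have hlim := (tendsto_sum_altBlock hm hA).const_mul (n : ℝ)
    rw [← hm2] at hlim
    have hval := tendsto_nhds_unique (tendsto_csc_sum he) hlim
    rw [← hS] at hval
    have hSval : S = 2 * (n : ℝ) * Real.log 2 / Real.pi + Real.pi / (12 * (n : ℝ))
        - 4 * n * A / Real.pi := by
      rw [hnm] at hval ⊢
      field_simp at hval ⊢
      linear_combination hval / 8
    rw [hSval]
    constructor
    · have : 4 * n * A / Real.pi < 7 * Real.pi ^ 3 / (1440 * (n : ℝ) ^ 3) := by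
        have h1 : A < 7 * Real.pi ^ 4 / (5760 * (n : ℝ) ^ 4) := by
          rw [hnm]
          refine (sub_pos.1 hQpos).trans_eq ?_
          field_simp
          norm_num
        calc 4 * n * A / Real.pi
            < 4 * n * (7 * Real.pi ^ 4 / (5760 * (n : ℝ) ^ 4)) / Real.pi := by gcongr
          _ = 7 * Real.pi ^ 3 / (1440 * (n : ℝ) ^ 3) := by field_simp; norm_num
      linarith
    · have : 0 < 4 * n * A / Real.pi := by positivity
      linarith
  · have key : ∑ l ∈ Finset.Ico 1 n,
        (-1 : ℝ) ^ (l + 1) * (1 / Real.sin (Real.pi * (l : ℝ) / (n : ℝ)))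
        = ∑ l ∈ Finset.Ico 1 n,
          -((-1 : ℝ) ^ (l + 1) * (1 / Real.sin (Real.pi * (l : ℝ) / (n : ℝ)))) := by
      refine Finset.sum_bij' (fun l _ => n - l) (fun l _ => n - l) ?_ ?_ ?_ ?_ ?_
      · intro l hl; simp only [Finset.mem_Ico] at *; omega
      · intro l hl; simp only [Finset.mem_Ico] at *; omega
      · intro l hl; simp only [Finset.mem_Ico] at *; omega
      · intro l hl; simp only [Finset.mem_Ico] at *; omega
      · intro l hl
        simp only [Finset.mem_Ico] at hl
        -- For odd `n`, `l` and `n - l` have opposite parity.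
        have hp : (-1 : ℝ) ^ (l + 1) = -(-1) ^ (n - l + 1) := by
          rw [← neg_one_mul ((-1 : ℝ) ^ _), ← pow_succ', neg_one_pow_congr]
          simp only [Nat.even_add_one, Nat.even_sub hl.2.le]
          have := Nat.not_even_iff_odd.2 ho
          tauto
        rw [hp, Nat.cast_sub hl.2.le, neg_mul,
          show Real.pi * ((n : ℝ) - l) / n = Real.pi - Real.pi * l / n by field_simp,
          Real.sin_pi_sub]
    rw [Finset.sum_neg_distrib] at key
    linarith
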